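/- All graphs are finite, undirected and simple, and the eigenvalues of a graph are those of its adjacency matrix. A Terwilliger graph is a connected non-complete graph $\Gamma$ such that, for some fixed integer $\mu \ge 1$, for any two vertices $u, v$ at distance two the set of common neighbours of $u$ and $v$ is a clique of size $\mu$. A $k$-regular graph is strongly regular if there are constants $a$ and $c$ such that any two adjacent vertices have exactly $a$ common neighbours and any two distinct non-adjacent vertices have exactly $c$ common neighbours. Let $m \ge 2$ be an integer. Then there are, up to isomorphism, only finitely many non-complete strongly regular Terwilliger graphs with smallest eigenvalue at least $-m$. -/

import Mathlib

/-- A Terwilliger graph: a connected non-complete graph such that, for any two vertices `u`, `v`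
at distance two, the common neighbours of `u` and `v` form a clique of size `μ`, for some fixed
`μ ≥ 1`. -/
def SimpleGraph.IsTerwilliger {V : Type*} (G : SimpleGraph V) : Prop :=
  G.Connected ∧ G ≠ ⊤ ∧
    ∃ μ : ℕ, 1 ≤ μ ∧ ∀ u v : V, G.dist u v = 2 →
      G.IsClique (G.commonNeighbors u v) ∧ (G.commonNeighbors u v).ncard = μ

/-- A graph is strongly regular if it is strongly regular with some parameters. -/
def SimpleGraph.IsStronglyRegular {V : Type*} [Fintype V] [DecidableEq V] (G : SimpleGraph V)
    [DecidableRel G.Adj] : Prop :=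
  ∃ n k a c : ℕ, G.IsSRGWith n k a c

/-- `θ` is the smallest eigenvalue of the graph `G`, that is, of its real adjacency matrix. -/
def SimpleGraph.IsSmallestEigenvalue {V : Type*} [Fintype V] [DecidableEq V] (G : SimpleGraph V)
    [DecidableRel G.Adj] (θ : ℝ) : Prop :=
  IsLeast {η : ℝ | Module.End.HasEigenvalue (Matrix.toLin' (G.adjMatrix ℝ)) η} θ

/-!
Let `A` be the adjacency matrix of a strongly regular graph with parameters `n`, `k`, `a`, `c`, and
let `r` and `-t` be its eigenvalues other than `k`, so that `r - t = a - c`, `r * t = k - c` and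
`0 < t ≤ m`. Then `r ≤ c * m ^ 2`, and hence `k` is at most a constant times `c`. This is clear if
`a < c`. If `c ≤ a`, the multiplicities force `t` to be an integer. For a coclique `Y` in the
neighbourhood of a vertex `x`, the closed neighbourhoods in `N(x)` of any two members of `Y` meet
in exactly `c - 1` vertices, because common neighbourhoods are cliques. If `Y` is maximal, these
sets cover `N(x)`, and counting multiplicities shows that `Y` has more than `t` members;
Bonferroni's inequality for `t + 1` of them then gives `r ≤ c * t ^ 2`.

It remains to treat large `c`. Since `A + m` is positive semidefinite, a vertex outside a clique is
adjacent to at most `2 * m ^ 2` of its vertices, or to all but at most `2 * m ^ 2` of them. For the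
clique of the common neighbours of two non-adjacent vertices `u` and `v`, only `2 * m ^ 2`
non-neighbours of `u` are of the second kind. Counting the edges between this clique and the
non-neighbours of `u` bounds the number of these by a constant, and its square bounds `k`.
-/

namespace Terwilliger

open Finset SimpleGraph Matrix

section CoverCount

variable {ι α : Type*} [DecidableEq α] {s : Finset ι} {A : ι → Finset α}

/-- The number of members of the family `A`, indexed by `s`, that contain the point `z`. -/
def coverCount (s : Finset ι) (A : ι → Finset α) (z : α) : ℕ :=
  #{i ∈ s | z ∈ A i}

lemma coverCount_pos {z : α} (hz : z ∈ s.biUnion A) : 0 < coverCount s A z := by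
  obtain ⟨i, hi, hz⟩ := mem_biUnion.mp hz
  exact card_pos.mpr ⟨i, mem_filter.mpr ⟨hi, hz⟩⟩

lemma coverCount_le_card (z : α) : coverCount s A z ≤ #s :=
  card_filter_le _ _

lemma sum_card_eq_sum_coverCount {U : Finset α} (hU : ∀ i ∈ s, A i ⊆ U) :
    ∑ i ∈ s, #(A i) = ∑ z ∈ U, coverCount s A z := by
  refine Eq.trans (sum_congr rfl fun i hi ↦ congrArg card ?_)
    (sum_card_bipartiteAbove_eq_sum_card_bipartiteBelow fun i z ↦ z ∈ A i)
  rw [bipartiteAbove, filter_mem_eq_inter, inter_eq_right.mpr (hU i hi)]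

lemma coverCount_offDiag (z : α) :
    coverCount s.offDiag (fun p ↦ A p.1 ∩ A p.2) z =
      coverCount s A z * (coverCount s A z - 1) := by
  rw [Nat.mul_sub_one, coverCount, coverCount, ← offDiag_card]
  congr 1
  ext p
  simp only [mem_offDiag, mem_filter, mem_inter]
  tauto

lemma sum_offDiag_card_inter_eq_sum_coverCount :
    ∑ p ∈ s.offDiag, #(A p.1 ∩ A p.2) =
      ∑ z ∈ s.biUnion A, coverCount s A z * (coverCount s A z - 1) := by
  rw [sum_card_eq_sum_coverCount fun p hp ↦ inter_subset_left.trans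
    (subset_biUnion_of_mem A (mem_offDiag.mp hp).1)]
  exact sum_congr rfl fun z _ ↦ coverCount_offDiag z

theorem two_mul_sum_card_le_two_mul_card_biUnion_add :
    2 * ∑ i ∈ s, #(A i) ≤ 2 * #(s.biUnion A) + ∑ p ∈ s.offDiag, #(A p.1 ∩ A p.2) := by
  rw [sum_offDiag_card_inter_eq_sum_coverCount,
    sum_card_eq_sum_coverCount fun _ ↦ subset_biUnion_of_mem A, card_eq_sum_ones,
    mul_sum, mul_sum, ← sum_add_distrib]
  refine sum_le_sum fun z hz ↦ ?_
  obtain ⟨j, hj⟩ := Nat.exists_eq_succ_of_ne_zero (coverCount_pos hz).ne'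
  rw [hj, Nat.succ_sub_one]
  -- A point covered `j + 1` times contributes `2 (j + 1) ≤ 2 + (j + 1) j`.
  nlinarith [Nat.le_mul_self j]

theorem sum_offDiag_card_inter_add_le :
    ∑ p ∈ s.offDiag, #(A p.1 ∩ A p.2) + #s * #(s.biUnion A) ≤ #s * ∑ i ∈ s, #(A i) := by
  rw [sum_offDiag_card_inter_eq_sum_coverCount,
    sum_card_eq_sum_coverCount fun _ ↦ subset_biUnion_of_mem A,
    card_eq_sum_ones (s.biUnion A), mul_sum, mul_sum, ← sum_add_distrib]
  refine sum_le_sum fun z hz ↦ ?_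
  obtain ⟨j, hj⟩ := Nat.exists_eq_succ_of_ne_zero (coverCount_pos hz).ne'
  have hjs : j + 1 ≤ #s := hj.symm.trans_le (coverCount_le_card z)
  rw [hj, Nat.succ_sub_one]
  -- A point covered `j + 1` times contributes `(j + 1) j + s ≤ s (j + 1)`.
  nlinarith

end CoverCount

section LinearAlgebra

lemma mem_spectrum_of_mul_eq_smul {R A : Type*} [CommRing R] [Ring A] [Algebra R A] {θ : R}
    {a b : A} (hab : a * b = θ • b) (hb : b ≠ 0) : θ ∈ spectrum R a := by
  rw [spectrum.mem_iff]
  refine fun hunit ↦ hb (hunit.mul_right_eq_zero.mp ?_)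
  rw [sub_mul, hab, ← Algebra.smul_def, sub_self]

lemma exists_nat_trace_eq_of_isIdempotentElem {ι K : Type*} [Fintype ι] [Field K]
    {E : Matrix ι ι K} (hE : IsIdempotentElem E) : ∃ f : ℕ, E.trace = f := by
  classical
  have hlin : IsIdempotentElem (Matrix.toLin' E) := by
    rw [IsIdempotentElem, Module.End.mul_eq_comp, ← Matrix.toLin'_mul, hE.eq]
  have htrace := ((LinearMap.isProj_range_iff_isIdempotentElem _).mpr hlin).trace
  rw [Matrix.trace_toLin'_eq] at htrace
  exact ⟨_, htrace⟩

lemma exists_nat_trace_eq_mul_of_mul_self_eq_smul {ι K : Type*} [Fintype ι] [Field K]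
    {E : Matrix ι ι K} {d : K} (hd : d ≠ 0) (hE : E * E = d • E) :
    ∃ f : ℕ, E.trace = d * f := by
  classical
  have hidem : IsIdempotentElem (d⁻¹ • E) := by
    rw [IsIdempotentElem, smul_mul_smul_comm, hE, smul_smul, mul_assoc, inv_mul_cancel₀ hd,
      mul_one]
  obtain ⟨f, hf⟩ := exists_nat_trace_eq_of_isIdempotentElem hidem
  rw [trace_smul, smul_eq_mul, inv_mul_eq_iff_eq_mul₀ hd] at hf
  exact ⟨f, hf⟩

lemma exists_int_eq_of_sq_eq {q : ℚ} {b d : ℤ} (h : q ^ 2 = b * q + d) : ∃ z : ℤ, (z : ℚ) = q := by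
  open Polynomial in
  have hint : IsIntegral ℤ q := by
    refine ⟨X ^ 2 - (C b * X + C d), monic_X_pow_sub (degree_linear_le.trans_lt (by norm_num)), ?_⟩
    simp only [eval₂_sub, eval₂_add, eval₂_mul, eval₂_C, eval₂_X_pow, eval₂_X, h]
    simp
  exact IsIntegrallyClosed.isIntegral_iff.mp hint

end LinearAlgebra

section Eigenvalues

variable {V : Type*} [Fintype V] [DecidableEq V] {G : SimpleGraph V} [DecidableRel G.Adj]
  {n k a c : ℕ} {θ τ : ℝ}

/-- The all-ones matrix `J`. -/
def allOnes (V : Type*) : Matrix V V ℝ :=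
  Matrix.of fun _ _ ↦ 1

omit [DecidableEq V] in
lemma allOnes_mul_allOnes : allOnes V * allOnes V = (Fintype.card V : ℝ) • allOnes V := by
  ext v w
  simp [allOnes, Matrix.mul_apply]

omit [DecidableEq V] in
lemma trace_allOnes : (allOnes V).trace = Fintype.card V := by
  simp [allOnes, Matrix.trace]

omit [DecidableEq V] in
lemma adjMatrix_mul_allOnes (hG : G.IsRegularOfDegree k) :
    G.adjMatrix ℝ * allOnes V = (k : ℝ) • allOnes V := by
  ext v w
  simp [allOnes, hG.degree_eq v]

omit [DecidableEq V] in
lemma allOnes_mul_adjMatrix (hG : G.IsRegularOfDegree k) :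
    allOnes V * G.adjMatrix ℝ = (k : ℝ) • allOnes V := by
  ext v w
  simp [allOnes, hG.degree_eq w]

omit [Fintype V] in
lemma adjMatrix_compl_eq : Gᶜ.adjMatrix ℝ = allOnes V - 1 - G.adjMatrix ℝ := by
  ext v w
  by_cases hvw : v = w
  · simp [allOnes, hvw]
  · by_cases hadj : G.Adj v w <;> simp [allOnes, hvw, hadj]

lemma adjMatrix_mul_self (h : G.IsSRGWith n k a c) :
    G.adjMatrix ℝ * G.adjMatrix ℝ =
      ((k : ℝ) - c) • 1 + ((a : ℝ) - c) • G.adjMatrix ℝ + (c : ℝ) • allOnes V := by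
  have hsq := h.matrix_eq (α := ℝ)
  rw [pow_two, adjMatrix_compl_eq, ← Nat.cast_smul_eq_nsmul ℝ, ← Nat.cast_smul_eq_nsmul ℝ a,
    ← Nat.cast_smul_eq_nsmul ℝ c] at hsq
  rw [hsq]
  module

omit [DecidableEq V] in
lemma card_mul_eq_mul_degree_sub [Nonempty V] (h : G.IsSRGWith n k a c) (hsum : θ + τ = a - c)
    (hprod : θ * τ = c - k) : (Fintype.card V : ℝ) * c = (k - θ) * (k - τ) := by
  classical
  obtain ⟨v⟩ := ‹Nonempty V›
  have hAAJ : G.adjMatrix ℝ * G.adjMatrix ℝ * allOnes V = ((k : ℝ) * k) • allOnes V := by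
    rw [Matrix.mul_assoc, adjMatrix_mul_allOnes h.regular, mul_smul_comm,
      adjMatrix_mul_allOnes h.regular, smul_smul]
  rw [adjMatrix_mul_self h, add_mul, add_mul, smul_mul_assoc, smul_mul_assoc, smul_mul_assoc,
    one_mul, adjMatrix_mul_allOnes h.regular, allOnes_mul_allOnes] at hAAJ
  have hentry := congrFun (congrFun hAAJ v) v
  simp only [allOnes, Matrix.add_apply, Matrix.smul_apply, Matrix.of_apply, smul_eq_mul,
    mul_one] at hentry
  linear_combination hentry + k * hsum - hprod

/-- For a strongly regular graph with eigenvalues `k`, `θ` and `τ`, this is `θ - τ` times the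
orthogonal projection onto the `θ`-eigenspace; it is kept free of the division by `θ - τ`. -/
noncomputable def eigenComponent (G : SimpleGraph V) [DecidableRel G.Adj] (k : ℕ) (τ : ℝ) :
    Matrix V V ℝ :=
  G.adjMatrix ℝ - τ • 1 - ((k - τ) / Fintype.card V) • allOnes V

lemma adjMatrix_mul_eigenComponent [Nonempty V] (h : G.IsSRGWith n k a c) (hsum : θ + τ = a - c)
    (hprod : θ * τ = c - k) :
    G.adjMatrix ℝ * eigenComponent G k τ = θ • eigenComponent G k τ := by
  set κ : ℝ := (k - τ) / Fintype.card V with hκ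
  have hcκ : (c : ℝ) = (k - θ) * κ := by
    rw [hκ, ← mul_div_assoc, ← card_mul_eq_mul_degree_sub h hsum hprod,
      mul_div_cancel_left₀ _ (Nat.cast_ne_zero.mpr Fintype.card_ne_zero)]
  have hA : (a : ℝ) - c - τ = θ := by linarith
  have hone : (k : ℝ) - c = -(θ * τ) := by linarith
  have hJ : (c : ℝ) - κ * k = -(θ * κ) := by linarith
  calc G.adjMatrix ℝ * eigenComponent G k τ
      = ((k : ℝ) - c) • (1 : Matrix V V ℝ) + ((a : ℝ) - c - τ) • G.adjMatrix ℝ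
          + ((c : ℝ) - κ * k) • allOnes V := by
        rw [eigenComponent, mul_sub, mul_sub, mul_smul_comm, mul_smul_comm, mul_one,
          adjMatrix_mul_self h, adjMatrix_mul_allOnes h.regular]
        module
    _ = θ • eigenComponent G k τ := by
        rw [hone, hA, hJ, eigenComponent]
        module

lemma allOnes_mul_eigenComponent [Nonempty V] (hG : G.IsRegularOfDegree k) (τ : ℝ) :
    allOnes V * eigenComponent G k τ = 0 := by
  have hcard : (Fintype.card V : ℝ) ≠ 0 := Nat.cast_ne_zero.mpr Fintype.card_ne_zero
  rw [eigenComponent, mul_sub, mul_sub, mul_smul_comm, mul_smul_comm, mul_one,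
    allOnes_mul_adjMatrix hG, allOnes_mul_allOnes, smul_smul, div_mul_cancel₀ _ hcard]
  module

lemma eigenComponent_mul_self [Nonempty V] (h : G.IsSRGWith n k a c) (hsum : θ + τ = a - c)
    (hprod : θ * τ = c - k) :
    eigenComponent G k τ * eigenComponent G k τ = (θ - τ) • eigenComponent G k τ := by
  nth_rewrite 1 [eigenComponent]
  rw [sub_mul, sub_mul, smul_mul_assoc, smul_mul_assoc, one_mul,
    adjMatrix_mul_eigenComponent h hsum hprod, allOnes_mul_eigenComponent h.regular]
  module

lemma trace_eigenComponent [Nonempty V] (G : SimpleGraph V) [DecidableRel G.Adj] (k : ℕ) (τ : ℝ) :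
    (eigenComponent G k τ).trace = -τ * (Fintype.card V - 1) - k := by
  have hcard : (Fintype.card V : ℝ) ≠ 0 := Nat.cast_ne_zero.mpr Fintype.card_ne_zero
  rw [eigenComponent, trace_sub, trace_sub, trace_smul, trace_smul, trace_adjMatrix, trace_one,
    trace_allOnes, smul_eq_mul, smul_eq_mul, div_mul_cancel₀ _ hcard]
  ring

theorem mem_spectrum_adjMatrix [Nonempty V] (h : G.IsSRGWith n k a c) (hk : 0 < k)
    (hsum : θ + τ = a - c) (hprod : θ * τ = c - k) (hτ : 0 ≤ τ) :
    θ ∈ spectrum ℝ (G.adjMatrix ℝ) := by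
  refine mem_spectrum_of_mul_eq_smul (adjMatrix_mul_eigenComponent h hsum hprod) fun hzero ↦ ?_
  have htrace := trace_eigenComponent G k τ
  rw [hzero, trace_zero] at htrace
  have hcard : (1 : ℝ) ≤ Fintype.card V := by exact_mod_cast Fintype.card_pos (α := V)
  have hk' : (0 : ℝ) < k := by exact_mod_cast hk
  nlinarith

omit [DecidableEq V] in
theorem exists_int_eq_eigenvalue [Nonempty V] (h : G.IsSRGWith n k a c) (hk : 0 < k) (hca : c ≤ a)
    (hne : θ ≠ τ) (hsum : θ + τ = a - c) (hprod : θ * τ = c - k) : ∃ z : ℤ, (z : ℝ) = θ := by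
  classical
  obtain ⟨f, hf⟩ := exists_nat_trace_eq_mul_of_mul_self_eq_smul (sub_ne_zero.mpr hne)
    (eigenComponent_mul_self h hsum hprod)
  rw [trace_eigenComponent] at hf
  obtain rfl : τ = a - c - θ := by linarith
  -- Once `τ` is eliminated, the trace equation is linear in `θ`, so `θ` is rational.
  have hlin : θ * (2 * f - (Fintype.card V - 1)) =
      (a - c) * f - (a - c) * (Fintype.card V - 1) - k := by linear_combination -hf
  have hcoeff : (2 * f - (Fintype.card V - 1) : ℝ) ≠ 0 := by
    intro h0
    have hk' : (0 : ℝ) < k := by exact_mod_cast hk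
    have hca' : (0 : ℝ) ≤ (a - c) * f :=
      mul_nonneg (sub_nonneg.mpr (by exact_mod_cast hca)) f.cast_nonneg
    rw [h0] at hlin
    nlinarith
  obtain ⟨q, rfl⟩ : ∃ q : ℚ, (q : ℝ) = θ := by
    refine ⟨((a - c) * f - (a - c) * (Fintype.card V - 1) - k) /
      (2 * f - (Fintype.card V - 1)), ?_⟩
    push_cast
    rw [div_eq_iff hcoeff, hlin]
  have hroot : q ^ 2 = ((a - c : ℤ) : ℚ) * q + ((k - c : ℤ) : ℚ) := by
    have : (q : ℝ) ^ 2 = (a - c) * q + (k - c) := by linear_combination -hprod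
    exact_mod_cast this
  obtain ⟨z, rfl⟩ := exists_int_eq_of_sq_eq hroot
  exact ⟨z, by norm_cast⟩

end Eigenvalues

section SpectralBound

variable {V : Type*} [Fintype V] [DecidableEq V] {G : SimpleGraph V} [DecidableRel G.Adj] {x : ℝ}

lemma posSemidef_adjMatrix_add_smul_one (h : ∀ η ∈ spectrum ℝ (G.adjMatrix ℝ), -x ≤ η) :
    (G.adjMatrix ℝ + x • 1).PosSemidef := by
  rw [posSemidef_iff_isHermitian_and_spectrum_nonneg, ← Algebra.algebraMap_eq_smul_one]
  refine ⟨?_, ?_⟩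
  · rw [IsHermitian, conjTranspose_eq_transpose_of_trivial, Algebra.algebraMap_eq_smul_one]
    simp
  · rw [← spectrum.add_singleton_eq, Set.add_singleton]
    rintro _ ⟨η, hη, rfl⟩
    exact neg_le_iff_add_nonneg.mp (h η hη)

/-- The indicator vector of a set of vertices, the building block of the test vectors for the
quadratic form of the adjacency matrix. -/
def indicatorVec (S : Finset V) : V → ℝ :=
  fun v ↦ if v ∈ S then 1 else 0

lemma indicatorVec_dotProduct (S T : Finset V) :
    indicatorVec S ⬝ᵥ indicatorVec T = #(S ∩ T) := by
  simp [indicatorVec, dotProduct, inter_comm]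

lemma indicatorVec_dotProduct_adjMatrix_mulVec (S T : Finset V) :
    indicatorVec S ⬝ᵥ G.adjMatrix ℝ *ᵥ indicatorVec T = #(G.interedges S T) := by
  have hrow (v : V) : (∑ w, if G.Adj v w then indicatorVec S v * indicatorVec T w else 0) =
      if v ∈ S then ∑ w ∈ T, if G.Adj v w then (1 : ℝ) else 0 else 0 := by
    by_cases hv : v ∈ S
    · simp [indicatorVec, hv, ← ite_and, and_comm, filter_and, inter_filter]
    · simp [indicatorVec, hv]
  rw [dotProduct_mulVec_adjMatrix, interedges_def, ← sum_boole, sum_product]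
  simp [hrow]

lemma indicatorVec_dotProduct_adjMatrix_add_smul_one_mulVec (S T : Finset V) :
    indicatorVec S ⬝ᵥ (G.adjMatrix ℝ + x • 1) *ᵥ indicatorVec T =
      #(G.interedges S T) + x * #(S ∩ T) := by
  rw [add_mulVec, dotProduct_add, smul_mulVec, one_mulVec, dotProduct_smul,
    indicatorVec_dotProduct, indicatorVec_dotProduct_adjMatrix_mulVec, smul_eq_mul]

omit [Fintype V] [DecidableEq V] in
lemma card_interedges_eq_mul {S T : Finset V} (h : ∀ v ∈ S, ∀ w ∈ T, G.Adj v w) :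
    #(G.interedges S T) = #S * #T := by
  rw [interedges_def, filter_true_of_mem, card_product]
  exact fun e he ↦ h _ (mem_product.mp he).1 _ (mem_product.mp he).2

omit [Fintype V] [DecidableEq V] in
lemma card_interedges_eq_zero {S T : Finset V} (h : ∀ v ∈ S, ∀ w ∈ T, ¬G.Adj v w) :
    #(G.interedges S T) = 0 := by
  rw [interedges_def, filter_false_of_mem, card_empty]
  exact fun e he ↦ h _ (mem_product.mp he).1 _ (mem_product.mp he).2

omit [Fintype V] in
lemma quadraticForm_nonneg_of_disjoint [Finite V] (hG : (G.adjMatrix ℝ + x • 1).PosSemidef)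
    {S P W : Finset V} (hSP : Disjoint S P) (hSW : Disjoint S W) (hPW : Disjoint P W) (α β γ : ℝ) :
    0 ≤ α ^ 2 * (#(G.interedges S S) + x * #S) + β ^ 2 * (#(G.interedges P P) + x * #P)
      + γ ^ 2 * (#(G.interedges W W) + x * #W) + 2 * (α * β * #(G.interedges S P)
      + α * γ * #(G.interedges S W) + β * γ * #(G.interedges P W)) := by
  cases nonempty_fintype V
  have hcomm (X Y : Finset V) : #(G.interedges X Y) = #(G.interedges Y X) :=
    have : Std.Symm G.Adj := ⟨fun _ _ ↦ G.adj_symm⟩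
    Rel.card_interedges_comm X Y
  have hform := hG.dotProduct_mulVec_nonneg
    (α • indicatorVec S + β • indicatorVec P + γ • indicatorVec W)
  simp only [star_trivial, mulVec_add, mulVec_smul, dotProduct_add, add_dotProduct,
    smul_dotProduct, dotProduct_smul, indicatorVec_dotProduct_adjMatrix_add_smul_one_mulVec,
    inter_self, inter_comm P S, inter_comm W S, inter_comm W P, hcomm P S, hcomm W S, hcomm W P,
    disjoint_iff_inter_eq_empty.mp hSP, disjoint_iff_inter_eq_empty.mp hSW,
    disjoint_iff_inter_eq_empty.mp hPW, card_empty, smul_eq_mul, Nat.cast_zero] at hform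
  linarith

omit [Fintype V] in
lemma card_le_of_joined_of_card_eq [Finite V]
    (hG : (G.adjMatrix ℝ + x • 1).PosSemidef) (hx : 0 < x) {u : V}
    {P W : Finset V} (hP : ∀ p ∈ P, G.Adj u p) (hW : ∀ w ∈ W, ¬G.Adj u w) (hu : u ∉ W)
    (hPW : ∀ p ∈ P, ∀ w ∈ W, G.Adj p w) (hcard : #P = #W) : (#P : ℝ) ≤ 2 * x ^ 2 := by
  have hform := quadraticForm_nonneg_of_disjoint hG
    (disjoint_singleton_left.mpr fun h ↦ (hP u h).ne rfl) (disjoint_singleton_left.mpr hu)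
    (disjoint_left.mpr fun v hp hw ↦ (hPW v hp v hw).ne rfl) (-#P) x (-x)
  rw [card_interedges_eq_zero (S := {u}) (T := {u}) (by simp),
    card_interedges_eq_mul (S := {u}) (T := P) (by simpa using hP),
    card_interedges_eq_zero (S := {u}) (T := W) (by simpa using hW),
    card_interedges_eq_mul hPW, card_singleton, ← hcard] at hform
  have hPP : (#(G.interedges P P) : ℝ) ≤ #P * #P := by exact_mod_cast G.card_interedges_le_mul P P
  have hWW : (#(G.interedges W W) : ℝ) ≤ #P * #P := by
    exact_mod_cast hcard ▸ G.card_interedges_le_mul W W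
  push_cast at hform
  by_contra! hlt
  -- The edges between `P` and `W` outweigh those inside, so the edges from `u` decide the sign.
  have hPpos : (0 : ℝ) < #P := lt_of_le_of_lt (by positivity) hlt
  nlinarith [mul_le_mul_of_nonneg_left hPP (sq_nonneg x),
    mul_le_mul_of_nonneg_left hWW (sq_nonneg x), mul_pos (mul_pos hx hPpos) (sub_pos.mpr hlt)]

omit [Fintype V] in
theorem card_le_or_card_le_of_joined [Finite V]
    (hG : (G.adjMatrix ℝ + x • 1).PosSemidef) (hx : 0 < x) {u : V}
    {P W : Finset V} (hP : ∀ p ∈ P, G.Adj u p) (hW : ∀ w ∈ W, ¬G.Adj u w) (hu : u ∉ W)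
    (hPW : ∀ p ∈ P, ∀ w ∈ W, G.Adj p w) : (#P : ℝ) ≤ 2 * x ^ 2 ∨ (#W : ℝ) ≤ 2 * x ^ 2 := by
  obtain ⟨P', hP', hPcard⟩ := exists_subset_card_eq (min_le_left #P #W)
  obtain ⟨W', hW', hWcard⟩ := exists_subset_card_eq (min_le_right #P #W)
  have hle := card_le_of_joined_of_card_eq hG hx (fun p hp ↦ hP p (hP' hp))
    (fun w hw ↦ hW w (hW' hw)) (fun h ↦ hu (hW' h)) (fun p hp w hw ↦ hPW p (hP' hp) w (hW' hw))
    (hPcard.trans hWcard.symm)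
  rwa [hPcard, Nat.cast_min, min_le_iff] at hle

end SpectralBound

section Neighbourhoods

variable {V : Type*} [Fintype V] [DecidableEq V] {G : SimpleGraph V} [DecidableRel G.Adj]
  {n k a c : ℕ} {u v w : V}

/-- The set of common neighbours of two vertices, as a `Finset` in order to be counted. -/
def commonNbrs (G : SimpleGraph V) [DecidableRel G.Adj] (u v : V) : Finset V :=
  G.neighborFinset u ∩ G.neighborFinset v

lemma mem_commonNbrs : w ∈ commonNbrs G u v ↔ G.Adj u w ∧ G.Adj v w := by
  simp [commonNbrs]

lemma coe_commonNbrs : (commonNbrs G u v : Set V) = G.commonNeighbors u v := by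
  ext w
  simp [mem_commonNbrs, mem_commonNeighbors]

lemma card_commonNbrs : #(commonNbrs G u v) = Fintype.card (G.commonNeighbors u v) := by
  rw [← Set.toFinset_card]
  congr 1
  ext w
  simp [mem_commonNbrs, mem_commonNeighbors]

lemma card_commonNbrs_of_adj (h : G.IsSRGWith n k a c) (huv : G.Adj u v) :
    #(commonNbrs G u v) = a :=
  card_commonNbrs.trans (h.of_adj u v huv)

lemma card_commonNbrs_of_compl_adj (h : G.IsSRGWith n k a c) (huv : Gᶜ.Adj u v) :
    #(commonNbrs G u v) = c :=
  card_commonNbrs.trans (h.of_not_adj huv.1 huv.2)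

omit [Fintype V] [DecidableEq V] [DecidableRel G.Adj] in
lemma exists_compl_adj (hG : G ≠ ⊤) : ∃ u v, Gᶜ.Adj u v :=
  ne_top_iff_exists_not_adj.mp hG

lemma isClique_commonNbrs (hT : G.IsTerwilliger) (huv : Gᶜ.Adj u v) :
    G.IsClique (commonNbrs G u v : Set V) := by
  obtain ⟨-, -, μ, -, hμ⟩ := hT
  rcases (commonNbrs G u v).eq_empty_or_nonempty with hempty | hne
  · simp [hempty]
  · have hdist : G.dist u v = 2 := by
      have hedist : G.edist u v = 2 :=
        edist_eq_two_iff.mpr ⟨huv.1, huv.2, coe_commonNbrs (G := G) ▸ hne⟩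
      rw [SimpleGraph.dist, hedist, ENat.toNat_ofNat]
    exact coe_commonNbrs (G := G) ▸ (hμ u v hdist).1

omit [DecidableEq V] in
lemma one_le_of_connected (h : G.IsSRGWith n k a c) (hconn : G.Connected) (hG : G ≠ ⊤) :
    1 ≤ c := by
  classical
  obtain ⟨u, v, hne, hadj⟩ := ne_top_iff_exists_not_adj.mp hG
  obtain ⟨p, hp⟩ := hconn.exists_walk_length_eq_dist u v
  obtain ⟨x, y, z, hxy, hyz, hxz, hne'⟩ :=
    p.exists_adj_adj_not_adj_ne hp (hconn.one_lt_dist_of_ne_of_not_adj hne hadj)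
  rw [← card_commonNbrs_of_compl_adj h ⟨hne', hxz⟩]
  exact card_pos.mpr ⟨y, mem_commonNbrs.mpr ⟨hxy, hyz.symm⟩⟩

omit [DecidableEq V] in
lemma add_two_le_degree (h : G.IsSRGWith n k a c) (hc : 1 ≤ c) (hG : G ≠ ⊤) : a + 2 ≤ k := by
  classical
  obtain ⟨u, v, huv⟩ := exists_compl_adj hG
  obtain ⟨z, hz⟩ : (commonNbrs G u v).Nonempty :=
    card_pos.mp ((card_commonNbrs_of_compl_adj h huv).symm ▸ hc)
  obtain ⟨huz, hvz⟩ := mem_commonNbrs.mp hz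
  have hsub : insert u (insert v (commonNbrs G z u)) ⊆ G.neighborFinset z := by
    simp only [insert_subset_iff, mem_neighborFinset]
    exact ⟨huz.symm, hvz.symm, inter_subset_left⟩
  have hcard := card_le_card hsub
  rwa [card_insert_of_notMem (by simp [mem_commonNbrs, huv.1]),
    card_insert_of_notMem (by simp [mem_commonNbrs, huv.2]),
    card_commonNbrs_of_adj h huz.symm, card_neighborFinset_eq_degree, h.regular z] at hcard

omit [DecidableEq V] in
lemma le_add_one_of_isTerwilliger (h : G.IsSRGWith n k a c) (hT : G.IsTerwilliger) (hc : 1 ≤ c) :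
    c ≤ a + 1 := by
  classical
  obtain ⟨u, v, huv⟩ := exists_compl_adj hT.2.1
  obtain ⟨z, hz⟩ : (commonNbrs G u v).Nonempty :=
    card_pos.mp ((card_commonNbrs_of_compl_adj h huv).symm ▸ hc)
  have hsub : (commonNbrs G u v).erase z ⊆ commonNbrs G u z := by
    intro w hw
    obtain ⟨hwz, hw⟩ := mem_erase.mp hw
    exact mem_commonNbrs.mpr
      ⟨(mem_commonNbrs.mp hw).1, isClique_commonNbrs hT huv hz hw hwz.symm⟩
  have hcard := card_le_card hsub
  rw [card_erase_of_mem hz, card_commonNbrs_of_compl_adj h huv,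
    card_commonNbrs_of_adj h (mem_commonNbrs.mp hz).1] at hcard
  omega

end Neighbourhoods

section LocalCocliques

variable {V : Type*} [Fintype V] [DecidableEq V] {G : SimpleGraph V} [DecidableRel G.Adj]
  {n k a c : ℕ} {x y z : V} {Y : Finset V}

/-- The closed neighbourhood of a vertex `y ∈ N(x)` in the subgraph induced on `N(x)`. -/
def closedLocalNbrs (G : SimpleGraph V) [DecidableRel G.Adj] (x y : V) : Finset V :=
  insert y (commonNbrs G x y)

lemma closedLocalNbrs_subset (hxy : G.Adj x y) : closedLocalNbrs G x y ⊆ G.neighborFinset x :=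
  insert_subset ((mem_neighborFinset G x y).mpr hxy) inter_subset_left

lemma card_closedLocalNbrs (h : G.IsSRGWith n k a c) (hxy : G.Adj x y) :
    #(closedLocalNbrs G x y) = a + 1 := by
  rw [closedLocalNbrs, card_insert_of_notMem (by simp [mem_commonNbrs]),
    card_commonNbrs_of_adj h hxy]

lemma closedLocalNbrs_inter_eq (hT : G.IsTerwilliger) (hxy : G.Adj x y) (hxz : G.Adj x z)
    (hyz : Gᶜ.Adj y z) :
    closedLocalNbrs G x y ∩ closedLocalNbrs G x z = (commonNbrs G y z).erase x := by
  have hx : x ∈ commonNbrs G y z := mem_commonNbrs.mpr ⟨hxy.symm, hxz.symm⟩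
  ext w
  simp only [closedLocalNbrs, mem_inter, mem_insert, mem_erase]
  constructor
  · rintro ⟨rfl | hwy, rfl | hwz⟩
    · exact absurd rfl hyz.1
    · exact absurd (mem_commonNbrs.mp hwz).2.symm hyz.2
    · exact absurd (mem_commonNbrs.mp hwy).2 hyz.2
    · rw [mem_commonNbrs] at *
      exact ⟨hwy.1.ne', hwy.2, hwz.2⟩
  · rintro ⟨hwx, hw⟩
    have hxw : G.Adj x w := isClique_commonNbrs hT hyz hx hw hwx.symm
    rw [mem_commonNbrs] at hw
    exact ⟨.inr (mem_commonNbrs.mpr ⟨hxw, hw.1⟩), .inr (mem_commonNbrs.mpr ⟨hxw, hw.2⟩)⟩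

lemma card_closedLocalNbrs_inter (h : G.IsSRGWith n k a c) (hT : G.IsTerwilliger)
    (hxy : G.Adj x y) (hxz : G.Adj x z) (hyz : Gᶜ.Adj y z) :
    #(closedLocalNbrs G x y ∩ closedLocalNbrs G x z) = c - 1 := by
  rw [closedLocalNbrs_inter_eq hT hxy hxz hyz,
    card_erase_of_mem (mem_commonNbrs.mpr ⟨hxy.symm, hxz.symm⟩),
    card_commonNbrs_of_compl_adj h hyz]

lemma sum_card_closedLocalNbrs (h : G.IsSRGWith n k a c) (hY : Y ⊆ G.neighborFinset x) :
    ∑ y ∈ Y, #(closedLocalNbrs G x y) = #Y * (a + 1) :=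
  sum_const_nat fun _ hy ↦ card_closedLocalNbrs h ((mem_neighborFinset ..).mp (hY hy))

lemma sum_offDiag_card_closedLocalNbrs_inter (h : G.IsSRGWith n k a c) (hT : G.IsTerwilliger)
    (hY : Y ⊆ G.neighborFinset x) (hind : G.IsIndepSet (Y : Set V)) :
    ∑ p ∈ Y.offDiag, #(closedLocalNbrs G x p.1 ∩ closedLocalNbrs G x p.2) =
      #Y * (#Y - 1) * (c - 1) := by
  rw [Nat.mul_sub_one #Y, ← offDiag_card]
  refine sum_const_nat fun p hp ↦ ?_
  obtain ⟨hp₁, hp₂, hne⟩ := mem_offDiag.mp hp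
  exact card_closedLocalNbrs_inter h hT ((mem_neighborFinset ..).mp (hY hp₁))
    ((mem_neighborFinset ..).mp (hY hp₂)) ⟨hne, hind hp₁ hp₂ hne⟩

omit [DecidableEq V] in
lemma two_mul_card_mul_le_of_isIndepSet (h : G.IsSRGWith n k a c) (hT : G.IsTerwilliger)
    (hY : Y ⊆ G.neighborFinset x) (hind : G.IsIndepSet (Y : Set V)) :
    2 * (#Y * (a + 1)) ≤ 2 * k + #Y * (#Y - 1) * (c - 1) := by
  classical
  have hunion : Y.biUnion (closedLocalNbrs G x) ⊆ G.neighborFinset x :=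
    biUnion_subset.mpr fun y hy ↦ closedLocalNbrs_subset ((mem_neighborFinset ..).mp (hY hy))
  have hcard := card_le_card hunion
  rw [card_neighborFinset_eq_degree, h.regular x] at hcard
  have hle := two_mul_sum_card_le_two_mul_card_biUnion_add (s := Y) (A := closedLocalNbrs G x)
  rw [sum_card_closedLocalNbrs h hY, sum_offDiag_card_closedLocalNbrs_inter h hT hY hind] at hle
  omega

lemma card_sub_one_mul_add_le_of_biUnion_eq (h : G.IsSRGWith n k a c) (hT : G.IsTerwilliger)
    (hY : Y ⊆ G.neighborFinset x) (hind : G.IsIndepSet (Y : Set V))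
    (hunion : Y.biUnion (closedLocalNbrs G x) = G.neighborFinset x) (hne : Y.Nonempty) :
    (#Y - 1) * (c - 1) + k ≤ #Y * (a + 1) := by
  have hle := sum_offDiag_card_inter_add_le (s := Y) (A := closedLocalNbrs G x)
  rw [sum_card_closedLocalNbrs h hY, sum_offDiag_card_closedLocalNbrs_inter h hT hY hind, hunion,
    card_neighborFinset_eq_degree, h.regular x, mul_assoc, ← mul_add] at hle
  exact Nat.le_of_mul_le_mul_left hle hne.card_pos

lemma exists_isIndepSet_biUnion_closedLocalNbrs_eq (G : SimpleGraph V) [DecidableRel G.Adj]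
    (x : V) : ∃ Y ⊆ G.neighborFinset x, G.IsIndepSet (Y : Set V) ∧
      Y.biUnion (closedLocalNbrs G x) = G.neighborFinset x := by
  obtain ⟨Y, -, hmax⟩ := Finite.exists_le_maximal
    (p := fun Y : Finset V ↦ Y ⊆ G.neighborFinset x ∧ G.IsIndepSet (Y : Set V)) (a := ∅) (by simp)
  obtain ⟨hY, hind⟩ := hmax.prop
  refine ⟨Y, hY, hind, subset_antisymm (biUnion_subset.mpr fun y hy ↦
    closedLocalNbrs_subset ((mem_neighborFinset ..).mp (hY hy))) fun z hz ↦ ?_⟩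
  by_contra hzY
  simp only [mem_biUnion, closedLocalNbrs, mem_insert, mem_commonNbrs, not_exists, not_and,
    not_or] at hzY
  have hinsert : G.IsIndepSet (insert z Y : Finset V) := by
    rw [← isClique_compl, coe_insert, isClique_insert]
    exact ⟨(isClique_compl G).mpr hind, fun y hy hne ↦
      ⟨hne, fun hzy ↦ (hzY y hy).2 ((mem_neighborFinset ..).mp hz) hzy.symm⟩⟩
  have hzmem := hmax.le_of_ge ⟨insert_subset hz hY, hinsert⟩ (subset_insert z Y)
    (mem_insert_self z Y)
  exact (hzY z hzmem).1 rfl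

omit [DecidableEq V] in
theorem le_mul_sq_of_isTerwilliger (h : G.IsSRGWith n k a c) (hT : G.IsTerwilliger)
    {r t : ℕ} (hc : 1 ≤ c) (hrt : r + c = a + t) (hk : k = c + r * t) : r ≤ c * t ^ 2 := by
  classical
  have hak := add_two_le_degree h hc hT.2.1
  obtain ⟨x⟩ := hT.1.nonempty
  obtain ⟨Y, hY, hind, hunion⟩ := exists_isIndepSet_biUnion_closedLocalNbrs_eq G x
  have hne : Y.Nonempty := by
    rw [nonempty_iff_ne_empty]
    rintro rfl
    have hdeg := h.regular x
    rw [← card_neighborFinset_eq_degree, ← hunion, biUnion_empty, card_empty] at hdeg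
    omega
  -- A maximal coclique with at most `t` vertices would contradict the covering inequality.
  have hlarge : t + 1 ≤ #Y := by
    by_contra! hle
    have hcover := card_sub_one_mul_add_le_of_biUnion_eq h hT hY hind hunion hne
    obtain ⟨s, hs⟩ := Nat.exists_eq_succ_of_ne_zero hne.card_pos.ne'
    obtain ⟨j, hj⟩ := Nat.exists_eq_add_of_le (Nat.le_of_lt_succ hle)
    obtain ⟨d, rfl⟩ := Nat.exists_eq_add_of_le' hc
    rw [hs] at hcover hj
    rw [Nat.succ_sub_one, Nat.add_sub_cancel] at hcover
    have hzero : s * s + j * (r + s + 1) ≤ 0 := by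
      subst hj hk
      nlinarith
    obtain rfl : s = 0 := by nlinarith
    omega
  obtain ⟨Z, hZY, hZ⟩ := exists_subset_card_eq hlarge
  have hpack := two_mul_card_mul_le_of_isIndepSet h hT (hZY.trans hY)
    (hind.mono (coe_subset.mpr hZY))
  obtain ⟨d, rfl⟩ := Nat.exists_eq_add_of_le' hc
  rw [hZ, Nat.add_sub_cancel, Nat.add_sub_cancel] at hpack
  nlinarith

end LocalCocliques

section DegreeOverMu

variable {V : Type*} [Fintype V] [DecidableEq V] {G : SimpleGraph V} [DecidableRel G.Adj]
  {n k a c m : ℕ} {r t : ℝ}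

lemma exists_pos_sub_eq_mul_eq (b : ℝ) {d : ℝ} (hd : 0 < d) :
    ∃ r t : ℝ, 0 < r ∧ 0 < t ∧ r - t = b ∧ r * t = d := by
  have habs : |b| < √(b ^ 2 + 4 * d) := Real.lt_sqrt_of_sq_lt (by rw [sq_abs]; linarith)
  obtain ⟨hneg, hpos⟩ := abs_lt.mp habs
  refine ⟨(√(b ^ 2 + 4 * d) + b) / 2, (√(b ^ 2 + 4 * d) - b) / 2, by linarith, by linarith,
    by ring, ?_⟩
  linear_combination Real.sq_sqrt (show 0 ≤ b ^ 2 + 4 * d by positivity) / 4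

omit [DecidableEq V] in
lemma eigenvalue_le_mul_sq_of_le (h : G.IsSRGWith n k a c) (hT : G.IsTerwilliger) (hc : 1 ≤ c)
    (hca : c ≤ a) (hr : 0 < r) (ht : 0 < t) (hsub : r - t = a - c) (hmul : r * t = k - c) :
    r ≤ c * t ^ 2 := by
  classical
  have : Nonempty V := hT.1.nonempty
  have hk : 0 < k := by linarith [add_two_le_degree h hc hT.2.1]
  obtain ⟨z, hz⟩ := exists_int_eq_eigenvalue (θ := -t) (τ := r) h hk hca (by linarith)
    (by linarith) (by linarith)
  have hz0 : 0 ≤ -z := by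
    have : (z : ℝ) ≤ 0 := by linarith
    exact neg_nonneg.mpr (by exact_mod_cast this)
  obtain ⟨T, hT'⟩ := Int.eq_ofNat_of_zero_le hz0
  obtain rfl : t = T := by
    have : (-z : ℝ) = T := by exact_mod_cast hT'
    linarith
  obtain ⟨b, rfl⟩ := Nat.exists_eq_add_of_le hca
  obtain rfl : r = (b + T : ℕ) := by
    push_cast at hsub ⊢
    linarith
  have hkR : k = c + (b + T) * T := by
    have : (k : ℝ) = c + ((b + T : ℕ) : ℝ) * T := by linarith
    exact_mod_cast this
  exact_mod_cast le_mul_sq_of_isTerwilliger h hT hc (by ring) hkR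

theorem degree_le_mul_of_isTerwilliger (h : G.IsSRGWith n k a c) (hT : G.IsTerwilliger)
    (hc : 1 ≤ c) (hm : 0 < m) (hspec : ∀ η ∈ spectrum ℝ (G.adjMatrix ℝ), -(m : ℝ) ≤ η) :
    k ≤ (m ^ 3 + 1) * c := by
  have : Nonempty V := hT.1.nonempty
  have hca := le_add_one_of_isTerwilliger h hT hc
  have hak := add_two_le_degree h hc hT.2.1
  have hck : (c : ℝ) < k := by exact_mod_cast (by omega : c < k)
  obtain ⟨r, t, hr, ht, hsub, hmul⟩ := exists_pos_sub_eq_mul_eq (a - c) (sub_pos.mpr hck)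
  have htm : t ≤ m := neg_le_neg_iff.mp <| hspec _ <|
    mem_spectrum_adjMatrix (τ := r) h (by omega) (by linarith) (by linarith) hr.le
  have hrm : r ≤ c * m ^ 2 := by
    rcases le_or_gt c a with hle | hlt
    · exact (eigenvalue_le_mul_sq_of_le h hT hc hle hr ht hsub hmul).trans (by gcongr)
    · have hrt : r ≤ t := by
        have : (a : ℝ) < c := by exact_mod_cast hlt
        linarith
      have hmc : m ≤ c * m ^ 2 :=
        (Nat.le_self_pow two_ne_zero m).trans (Nat.le_mul_of_pos_left _ hc)
      exact (hrt.trans htm).trans (by exact_mod_cast hmc)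
  have hkr : (k : ℝ) ≤ (m ^ 3 + 1) * c :=
    calc (k : ℝ) = c + r * t := by linarith
      _ ≤ c + c * m ^ 2 * m := by gcongr
      _ = (m ^ 3 + 1) * c := by ring
  exact_mod_cast hkr

end DegreeOverMu

section NonNeighbours

variable {V : Type*} [Fintype V] [DecidableEq V] {G : SimpleGraph V} [DecidableRel G.Adj]
  {n k a c m : ℕ} {u v w p : V} {C : Finset V}

lemma card_inter_le_or_card_sdiff_le_of_isClique (hG : (G.adjMatrix ℝ + (m : ℝ) • 1).PosSemidef)
    (hm : 0 < m) (hC : G.IsClique (C : Set V)) (hw : w ∉ C) :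
    #(C ∩ G.neighborFinset w) ≤ 2 * m ^ 2 ∨ #(C \ G.neighborFinset w) ≤ 2 * m ^ 2 := by
  have hjoin := card_le_or_card_le_of_joined hG (Nat.cast_pos.mpr hm) (u := w)
    (P := C ∩ G.neighborFinset w) (W := C \ G.neighborFinset w) (by simp) (by simp) (by simp [hw])
    fun p hp q hq ↦ hC (mem_inter.mp hp).1 (mem_sdiff.mp hq).1
      fun hpq ↦ (mem_sdiff.mp hq).2 (hpq ▸ (mem_inter.mp hp).2)
  exact_mod_cast hjoin

lemma card_filter_card_sdiff_le (hG : (G.adjMatrix ℝ + (m : ℝ) • 1).PosSemidef) (hm : 0 < m)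
    (hCu : C ⊆ G.neighborFinset u) (hC : 2 * m ^ 2 * (2 * m ^ 2 + 2) < #C) :
    #{w ∈ Gᶜ.neighborFinset u | #(C \ G.neighborFinset w) ≤ 2 * m ^ 2} ≤ 2 * m ^ 2 := by
  by_contra! hlt
  obtain ⟨T, hT, hTcard⟩ := exists_subset_card_eq (Nat.succ_le_of_lt hlt)
  have hTmem (w : V) (hw : w ∈ T) : Gᶜ.Adj u w ∧ #(C \ G.neighborFinset w) ≤ 2 * m ^ 2 := by
    simpa using hT hw
  set D := T.biUnion fun w ↦ C \ G.neighborFinset w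
  have hD : #D ≤ #T * (2 * m ^ 2) := card_biUnion_le_card_mul _ _ _ fun w hw ↦ (hTmem w hw).2
  have hjoin := card_le_or_card_le_of_joined hG (Nat.cast_pos.mpr hm) (u := u) (P := C \ D) (W := T)
    (fun p hp ↦ (mem_neighborFinset ..).mp (hCu (mem_sdiff.mp hp).1))
    (fun w hw ↦ (hTmem w hw).1.2) (fun hu ↦ (hTmem u hu).1.1 rfl) fun p hp w hw ↦ by
      by_contra hadj
      exact (mem_sdiff.mp hp).2 (mem_biUnion.mpr
        ⟨w, hw, by simpa [(mem_sdiff.mp hp).1] using fun hwp ↦ hadj hwp.symm⟩)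
  have hjoin' : #(C \ D) ≤ 2 * m ^ 2 ∨ #T ≤ 2 * m ^ 2 := by exact_mod_cast hjoin
  have hCD := le_card_sdiff D C
  rw [hTcard] at hD hjoin'
  have hsucc : (2 * m ^ 2).succ * (2 * m ^ 2) + 2 * m ^ 2 = 2 * m ^ 2 * (2 * m ^ 2 + 2) := by
    rw [Nat.succ_eq_add_one]
    ring
  omega

lemma card_compl_neighborFinset_inter (h : G.IsSRGWith n k a c) (hup : G.Adj u p) :
    #{w ∈ Gᶜ.neighborFinset u | G.Adj w p} = k - a - 1 := by
  have heq : {w ∈ Gᶜ.neighborFinset u | G.Adj w p} =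
      G.neighborFinset p \ insert u (commonNbrs G u p) := by
    ext w
    simp only [mem_filter, mem_neighborFinset, compl_adj, mem_sdiff, mem_insert, mem_commonNbrs,
      G.adj_comm w p]
    grind
  have hsub : insert u (commonNbrs G u p) ⊆ G.neighborFinset p :=
    insert_subset ((mem_neighborFinset ..).mpr hup.symm) inter_subset_right
  rw [heq, card_sdiff_of_subset hsub, card_insert_of_notMem (by simp [mem_commonNbrs]),
    card_commonNbrs_of_adj h hup, card_neighborFinset_eq_degree, h.regular p, Nat.sub_sub]

lemma sum_card_inter_neighborFinset (h : G.IsSRGWith n k a c) (hCu : C ⊆ G.neighborFinset u) :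
    ∑ w ∈ Gᶜ.neighborFinset u, #(C ∩ G.neighborFinset w) = #C * (k - a - 1) := by
  rw [sum_card_eq_sum_coverCount fun _ _ ↦ inter_subset_left]
  refine sum_const_nat fun p hp ↦ ?_
  rw [← card_compl_neighborFinset_inter h ((mem_neighborFinset ..).mp (hCu hp))]
  simp [coverCount, hp]

lemma card_mul_le_of_isClique (h : G.IsSRGWith n k a c)
    (hG : (G.adjMatrix ℝ + (m : ℝ) • 1).PosSemidef) (hm : 0 < m) (hC : G.IsClique (C : Set V))
    (hCu : C ⊆ G.neighborFinset u) (hcard : 2 * m ^ 2 * (2 * m ^ 2 + 2) < #C) :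
    #C * (k - a - 1) ≤ 2 * m ^ 2 * (#C + Gᶜ.degree u) := by
  rw [← sum_card_inter_neighborFinset h hCu, ← sum_filter_add_sum_filter_not _
    (fun w ↦ #(C \ G.neighborFinset w) ≤ 2 * m ^ 2), mul_add]
  gcongr ?_ + ?_
  · refine (sum_le_card_nsmul _ _ #C fun w _ ↦ card_le_card inter_subset_left).trans ?_
    exact Nat.mul_le_mul_right _ (card_filter_card_sdiff_le hG hm hCu hcard)
  · refine (sum_le_card_nsmul _ _ (2 * m ^ 2) fun w hw ↦ ?_).trans ?_
    · obtain ⟨hw, hfar⟩ := mem_filter.mp hw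
      refine (card_inter_le_or_card_sdiff_le_of_isClique hG hm hC fun hwC ↦ ?_).resolve_right hfar
      exact ((mem_neighborFinset ..).mp hw).2 ((mem_neighborFinset ..).mp (hCu hwC))
    · rw [smul_eq_mul, mul_comm, ← card_neighborFinset_eq_degree]
      exact Nat.mul_le_mul_left _ (card_filter_le _ _)

lemma degree_add_compl_degree_add_one (u : V) :
    G.degree u + Gᶜ.degree u + 1 = Fintype.card V := by
  have := G.degree_lt_card_verts u
  rw [degree_compl]
  omega

lemma degree_mul_eq_compl_degree_mul (h : G.IsSRGWith n k a c) (u : V) :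
    k * (k - a - 1) = Gᶜ.degree u * c := by
  have hcard := degree_add_compl_degree_add_one (G := G) u
  rw [h.card, h.regular u] at hcard
  have hn : 0 < n := by omega
  rw [h.param_eq _ hn]
  congr 1
  omega

theorem compl_degree_le_of_degree_le_mul (h : G.IsSRGWith n k a c) (hT : G.IsTerwilliger)
    (hG : (G.adjMatrix ℝ + (m : ℝ) • 1).PosSemidef) (hm : 0 < m) {b : ℕ} (hkb : k ≤ b * c)
    (hcm : 2 * m ^ 2 * (2 * m ^ 2 + 2) < c) (hcb : 2 * (2 * m ^ 2 * b) ≤ c) (huv : Gᶜ.Adj u v) :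
    Gᶜ.degree u ≤ 2 * (2 * m ^ 2 * b) := by
  have hC := card_commonNbrs_of_compl_adj h huv
  have hcount := card_mul_le_of_isClique (m := m) h hG hm (isClique_commonNbrs hT huv)
    inter_subset_left (hC ▸ hcm)
  rw [hC] at hcount
  have hle : Gᶜ.degree u * c ≤ 2 * m ^ 2 * b * (c + Gᶜ.degree u) :=
    calc Gᶜ.degree u * c = k * (k - a - 1) := (degree_mul_eq_compl_degree_mul h u).symm
      _ ≤ b * c * (k - a - 1) := Nat.mul_le_mul_right _ hkb
      _ = b * (c * (k - a - 1)) := mul_assoc ..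
      _ ≤ b * (2 * m ^ 2 * (c + Gᶜ.degree u)) := Nat.mul_le_mul_left _ hcount
      _ = 2 * m ^ 2 * b * (c + Gᶜ.degree u) := by ring
  nlinarith

lemma degree_sub_le_compl_degree (h : G.IsSRGWith n k a c) (huv : Gᶜ.Adj u v) :
    k - c ≤ Gᶜ.degree u := by
  have hsub : G.neighborFinset v \ G.neighborFinset u ⊆ Gᶜ.neighborFinset u := by
    intro w hw
    simp only [mem_sdiff, mem_neighborFinset] at hw
    exact (mem_neighborFinset ..).mpr ⟨fun huw ↦ huv.2 (huw ▸ hw.1.symm), hw.2⟩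
  have hcard := card_le_card hsub
  rwa [card_sdiff, ← commonNbrs, card_commonNbrs_of_compl_adj h huv,
    card_neighborFinset_eq_degree, card_neighborFinset_eq_degree, h.regular v] at hcard

theorem degree_le_compl_degree_sq (h : G.IsSRGWith n k a c) (hck : c < k) (huv : Gᶜ.Adj u v) :
    k ≤ Gᶜ.degree u ^ 2 := by
  have hparam := degree_mul_eq_compl_degree_mul h u
  have hpos : 0 < Gᶜ.degree u := (Gᶜ.degree_pos_iff_exists_adj u).mpr ⟨v, huv⟩
  have hlt : k - a - 1 < Gᶜ.degree u := by
    by_contra! hle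
    nlinarith
  calc k ≤ k * (Gᶜ.degree u - (k - a - 1)) :=
        Nat.le_mul_of_pos_right _ (Nat.sub_pos_of_lt hlt)
    _ = Gᶜ.degree u * (k - c) := by rw [Nat.mul_sub k, hparam, mul_comm k, Nat.mul_sub]
    _ ≤ Gᶜ.degree u ^ 2 := by
        rw [sq]
        exact Nat.mul_le_mul_left _ (degree_sub_le_compl_degree h huv)

end NonNeighbours

section Finiteness

variable {V : Type*} [Fintype V] [DecidableEq V] {G : SimpleGraph V} [DecidableRel G.Adj]
  {n k a c m : ℕ}

/-- A bound for the number of non-neighbours of a vertex in a strongly regular Terwilliger graph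
with smallest eigenvalue at least `-m` in which `c` is large. -/
def complDegreeBound (m : ℕ) : ℕ :=
  2 * (2 * m ^ 2 * (m ^ 3 + 1))

/-- A bound for the degree of a strongly regular Terwilliger graph with smallest eigenvalue at
least `-m`: the first summand serves when `c` is small, the second one when `c` is large. -/
def degreeBound (m : ℕ) : ℕ :=
  (m ^ 3 + 1) * (2 * m ^ 2 * (2 * m ^ 2 + 2) + complDegreeBound m) + complDegreeBound m ^ 2

theorem degree_le_degreeBound (h : G.IsSRGWith n k a c) (hT : G.IsTerwilliger) (hm : 0 < m)
    (hspec : ∀ η ∈ spectrum ℝ (G.adjMatrix ℝ), -(m : ℝ) ≤ η) : k ≤ degreeBound m := by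
  have hc := one_le_of_connected h hT.1 hT.2.1
  have hkc := degree_le_mul_of_isTerwilliger h hT hc hm hspec
  rcases le_or_gt c (2 * m ^ 2 * (2 * m ^ 2 + 2) + complDegreeBound m) with hsmall | hlarge
  · exact hkc.trans (le_add_right (Nat.mul_le_mul_left _ hsmall))
  · obtain ⟨u, v, huv⟩ := exists_compl_adj hT.2.1
    have hck : c < k := by
      linarith [add_two_le_degree h hc hT.2.1, le_add_one_of_isTerwilliger h hT hc]
    have hcompl : Gᶜ.degree u ≤ complDegreeBound m :=
      compl_degree_le_of_degree_le_mul h hT (posSemidef_adjMatrix_add_smul_one hspec) hm hkc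
        (lt_of_le_of_lt le_self_add hlarge) (le_add_self.trans hlarge.le) huv
    exact (degree_le_compl_degree_sq h hck huv).trans
      (le_add_left (Nat.pow_le_pow_left hcompl 2))

omit [DecidableEq V] in
lemma card_le_one_add_degree_add_sq [Nonempty V] (h : G.IsSRGWith n k a c) (hc : 1 ≤ c) :
    Fintype.card V ≤ 1 + k + k ^ 2 := by
  classical
  obtain ⟨u⟩ := ‹Nonempty V›
  have hcompl : Gᶜ.degree u ≤ k ^ 2 :=
    calc Gᶜ.degree u ≤ Gᶜ.degree u * c := Nat.le_mul_of_pos_right _ hc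
      _ = k * (k - a - 1) := (degree_mul_eq_compl_degree_mul h u).symm
      _ ≤ k ^ 2 := by
          rw [sq]
          exact Nat.mul_le_mul_left _ ((Nat.sub_le _ _).trans (Nat.sub_le _ _))
  rw [← degree_add_compl_degree_add_one (G := G) u, h.regular u]
  omega

theorem card_le_of_isTerwilliger (h : G.IsSRGWith n k a c) (hT : G.IsTerwilliger) (hm : 0 < m)
    (hspec : ∀ η ∈ spectrum ℝ (G.adjMatrix ℝ), -(m : ℝ) ≤ η) :
    Fintype.card V ≤ 1 + degreeBound m + degreeBound m ^ 2 := by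
  have : Nonempty V := hT.1.nonempty
  have hk := degree_le_degreeBound h hT hm hspec
  refine (card_le_one_add_degree_add_sq h (one_le_of_connected h hT.1 hT.2.1)).trans ?_
  gcongr

lemma le_of_mem_spectrum_adjMatrix {θ η : ℝ} (hθ : G.IsSmallestEigenvalue θ)
    (hη : η ∈ spectrum ℝ (G.adjMatrix ℝ)) : θ ≤ η :=
  hθ.2 (Module.End.hasEigenvalue_iff_mem_spectrum.mpr (by rwa [Matrix.spectrum_toLin']))

end Finiteness

end Terwilliger

/-- Finitely many up to isomorphism: a finite list of graphs contains an isomorphic copy of each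
graph with the stated properties. -/
theorem lemma7 (m : ℤ) (hm : 2 ≤ m) :
    ∃ S : Finset (Σ n : ℕ, SimpleGraph (Fin n)),
      ∀ (V : Type*) [Fintype V] [DecidableEq V] (G : SimpleGraph V) [DecidableRel G.Adj] (θ : ℝ),
        G ≠ ⊤ → G.IsStronglyRegular → G.IsTerwilliger →
        G.IsSmallestEigenvalue θ → -(m : ℝ) ≤ θ →
          ∃ H ∈ S, Nonempty (G ≃g H.2) := by
  classical
  lift m to ℕ using by omega
  set N := 1 + Terwilliger.degreeBound m + Terwilliger.degreeBound m ^ 2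
  refine ⟨(Finset.range (N + 1)).sigma fun _ ↦ Finset.univ, ?_⟩
  intro V _ _ G _ θ _ ⟨n, k, a, c, h⟩ hT hθ hmθ
  have hspec (η : ℝ) (hη : η ∈ spectrum ℝ (G.adjMatrix ℝ)) : -(m : ℝ) ≤ η :=
    hmθ.trans (Terwilliger.le_of_mem_spectrum_adjMatrix hθ hη)
  have hcard : Fintype.card V ≤ N := Terwilliger.card_le_of_isTerwilliger h hT (by omega) hspec
  exact ⟨⟨_, G.overFin rfl⟩, by simpa [Nat.lt_succ_iff] using hcard, ⟨G.overFinIso rfl⟩⟩
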